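/- Let $0\le a<b$ be fixed. For integers $N$ and $K\ge 1$ consider $N$ products $0,\dots,N-1$ and the set $S_N$ of permutations (rank lists) of the products, where $\sigma(i)$ is the rank of product $i$ and a smaller rank means more preferred. Draw a random choice model $\lambda:S_N\to[0,1]$ as follows (the generative model): choose $\sigma_1,\dots,\sigma_K\in S_N$ independently and uniformly at random (with replacement) and, independently of them, $K$ independent numbers uniformly distributed on $[a,b]$; normalise these numbers so that they sum to $1$, assign them to $\sigma_1,\dots,\sigma_K$ (weights of repeated permutations add up), and put $\lambda(\sigma)=0$ for every other $\sigma$. The data types are given by $0/1$ matrices $A$ with columns indexed by $S_N$. Comparison data: the rows are the ordered pairs $(i,j)$ of distinct products, and $A(\sigma)_{ij}=1$ iff $\sigma(i)<\sigma(j)$. Ranking data: the rows are the pairs $(r,i)$ of a rank and a product, and $A(\sigma)_{ri}=1$ iff $\sigma(i)=r$. Top-set data: comparison data together with one further row for each product $i$, in which $A(\sigma)_i=1$ iff $i$ has the top rank in $\sigma$. The model $\lambda$ satisfies the signature condition for $A$ if for every $\sigma$ in its support there is a row $d$ with $A(\sigma)_d=1$ and $A(\tau)_d=0$ for every other $\tau$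 in the support. It satisfies the linear independence condition with bound $C$ if $\sum_{\sigma\in\operatorname{supp}\lambda}c_\sigma\lambda(\sigma)\ne0$ for all integers $c_\sigma$, not all zero, with $|c_\sigma|\le C$. Then, for every sequence $K=K(N)\ge1$, with probability $1-o(1)$ as $N\to\infty$, the model $\lambda$ has support size exactly $K$ and satisfies both the signature condition for $A$ and the linear independence condition with every bound $C\ge K$, provided $K=o(\log N)$ if $A$ is the matrix of comparison data, $K=o(\sqrt N)$ if $A$ is the matrix of top-set data, and $K=O(N)$ if $A$ is the matrix of ranking data. -/

import Mathlib

open Filter Topology Asymptotics MeasureTheory ProbabilityTheory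

noncomputable section

namespace ChoiceModel

/-- A rank list over the `N` products `0, …, N - 1`: the permutation `σ` sends a product to its
rank. Ranks are counted from `0`, so that rank `0` is the most preferred position. -/
abbrev RankList (N : ℕ) : Type := Equiv.Perm (Fin N)

/-- The discrete `σ`-algebra on the finite set of rank lists. -/
instance instMeasurableSpaceRankList (N : ℕ) : MeasurableSpace (RankList N) := ⊤

instance instDiscreteMeasurableSpaceRankList (N : ℕ) : DiscreteMeasurableSpace (RankList N) :=
  ⟨fun _ => trivial⟩

/-! ### The three types of data, as matrices with columns indexed by rank lists -/

/-- Comparison data: rows are the ordered pairs `(i, j)` of distinct products, and the entry is `1`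
iff `i` is preferred to `j`. -/
def comparisonMatrix (N : ℕ) :
    Matrix {p : Fin N × Fin N // p.1 ≠ p.2} (RankList N) ℝ :=
  fun p σ => if σ p.1.1 < σ p.1.2 then 1 else 0

/-- Ranking data: rows are the pairs `(r, i)` of a rank and a product, and the entry is `1`
iff `i` has rank `r`. -/
def rankingMatrix (N : ℕ) : Matrix (Fin N × Fin N) (RankList N) ℝ :=
  fun p σ => if σ p.2 = p.1 then 1 else 0

/-- Top-choice data: rows are the products, and the entry is `1` iff the product is the most
preferred one. -/
def topChoiceMatrix (N : ℕ) : Matrix (Fin N) (RankList N) ℝ :=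
  fun i σ => if (σ i : ℕ) = 0 then 1 else 0

/-- Top-set data: the concatenation of comparison data and top-choice data. -/
def topSetMatrix (N : ℕ) :
    Matrix ({p : Fin N × Fin N // p.1 ≠ p.2} ⊕ Fin N) (RankList N) ℝ :=
  Matrix.fromRows (comparisonMatrix N) (topChoiceMatrix N)

/-! ### The two conditions on a choice model `lam` -/

/-- The sparsity `‖lam‖₀`: the number of rank lists in the support. -/
def sparsity {N : ℕ} (lam : RankList N → ℝ) : ℕ := {σ | lam σ ≠ 0}.ncard

/-- Signature condition: every `σ` in the support has a row `d` in which, among the rank lists of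
the support, exactly `σ` has the entry `1`, and all others have the entry `0`. -/
def SignatureCondition {N : ℕ} {D : Type*} (A : Matrix D (RankList N) ℝ)
    (lam : RankList N → ℝ) : Prop :=
  ∀ σ, lam σ ≠ 0 → ∃ d, A d σ = 1 ∧ ∀ τ, lam τ ≠ 0 → τ ≠ σ → A d τ = 0

/-- Linear independence condition with bound `C`: no integer combination of the values of `lam` on
its support, with coefficients at most `C` in absolute value and not all zero, vanishes. -/
def LinearIndependenceCondition {N : ℕ} (C : ℝ) (lam : RankList N → ℝ) : Prop :=
  ∀ c : RankList N → ℤ, (∀ σ, lam σ ≠ 0 → |(c σ : ℝ)| ≤ C) → (∃ σ, lam σ ≠ 0 ∧ c σ ≠ 0) →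
    ∑ σ, (c σ : ℝ) * lam σ ≠ 0

/-! ### The generative model -/

/-- The choice model that assigns to the rank lists `s 0, …, s (K - 1)` the weights
`w 0, …, w (K - 1)` after normalisation to total weight `1`, and `0` to all other rank lists
(weights of repeated rank lists add up). -/
def generated {N K : ℕ} (s : Fin K → RankList N) (w : Fin K → ℝ) : RankList N → ℝ :=
  fun τ => ∑ i, if s i = τ then w i / ∑ j, w j else 0

/-- The joint law of the draws: `K` independent uniformly random rank lists and, independently,
`K` independent numbers uniformly distributed on `[a, b]`. -/
def drawLaw (N K : ℕ) (a b : ℝ) : Measure ((Fin K → RankList N) × (Fin K → ℝ)) :=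
  (Measure.pi fun _ => (PMF.uniformOfFintype (RankList N)).toMeasure).prod
    (Measure.pi fun _ => ProbabilityTheory.cond volume (Set.Icc a b))

/-- The event that the generated choice model has support size `K` and satisfies the signature
condition for `A` and the linear independence condition, the latter with every bound `C ≥ K`. -/
def goodEvent {N : ℕ} (K : ℕ) {D : Type*} (A : Matrix D (RankList N) ℝ) :
    Set ((Fin K → RankList N) × (Fin K → ℝ)) :=
  {x | sparsity (generated x.1 x.2) = K ∧ SignatureCondition A (generated x.1 x.2) ∧
    ∀ C : ℝ, (K : ℝ) ≤ C → LinearIndependenceCondition C (generated x.1 x.2)}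

end ChoiceModel

end

/-
The normalised weights matter only up to a positive factor, and almost surely the raw weights are
linearly independent over `ℤ`, because each of the countably many hyperplanes with integer
coefficients is null for a product of atomless laws. It remains to find, for each draw `k`, a row
that separates it from the other draws, with failure probability `o(1 / K)` per draw.

For comparison and ranking data there are `N / 2` disjoint attempts: a comparison of two products
not compared before, or the rank that `k` gives to a new product. Right multiplication of each draw
by its own random transposition preserves the uniform law and the outcome of the earlier attempts,
so that whatever these were, the next attempt succeeds with conditional probability at least
`2 ^ (-K)`, respectively `(1 - 1 / (m + 1)) ^ K ≥ exp (-K / m)` while `m + 1` products are left,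
where `m ≥ N / 2`. For top-set data, two independent draws share their top product with probability
`1 / N`.
-/

namespace ChoiceModel

section Resampling

-- Moving a point of `B` by a uniformly random `f h` changes neither its law nor `B`, so the
-- conditional probability of `G` given `B` is at least `n / card H`.
theorem mul_measureReal_le_card_mul_measureReal_inter {Ω H : Type*} [MeasurableSpace Ω]
    [Fintype H] {μ : Measure Ω} [IsFiniteMeasure μ] {f : H → Ω → Ω}
    (hf : ∀ h, MeasurePreserving (f h) μ μ) {B G : Set Ω} (hB : MeasurableSet B)
    (hG : MeasurableSet G) (hfB : ∀ h, Set.MapsTo (f h) B B) {n : ℕ}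
    (hn : ∀ x ∈ B, n ≤ {h | f h x ∈ G}.ncard) :
    n * μ.real B ≤ Fintype.card H * μ.real (B ∩ G) := by
  classical
  have hcount (x : Ω) : ∑ h, (f h ⁻¹' G).indicator 1 x = ({h | f h x ∈ G}.ncard : ENNReal) := by
    simp [Set.indicator_apply, Finset.sum_boole, Set.ncard_eq_toFinset_card']
  have key : n * μ B ≤ Fintype.card H * μ (B ∩ G) := calc
    n * μ B = ∫⁻ _ in B, n ∂μ := (setLIntegral_const _ _).symm
    _ ≤ ∫⁻ x in B, ∑ h, (f h ⁻¹' G).indicator 1 x ∂μ :=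
      setLIntegral_mono' hB fun x hx => by rw [hcount]; exact_mod_cast hn x hx
    _ = ∑ h, μ (f h ⁻¹' G ∩ B) := by
      rw [lintegral_finsetSum _ fun h _ => measurable_one.indicator ((hf h).measurable hG)]
      refine Finset.sum_congr rfl fun h _ => ?_
      rw [lintegral_indicator_one ((hf h).measurable hG),
        Measure.restrict_apply ((hf h).measurable hG)]
    _ ≤ ∑ h, μ (f h ⁻¹' (B ∩ G)) :=
      Finset.sum_le_sum fun h _ => measure_mono fun x hx => ⟨hfB h hx.2, hx.1⟩
    _ = Fintype.card H * μ (B ∩ G) := by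
      simp only [(hf _).measure_preimage (hB.inter hG).nullMeasurableSet, Finset.sum_const,
        Finset.card_univ, nsmul_eq_mul]
  simpa [Measure.real, ENNReal.toReal_mul] using
    ENNReal.toReal_mono (ENNReal.mul_ne_top (by simp) (measure_ne_top _ _)) key

theorem measureReal_biInter_compl_le_one_sub_pow {Ω J : Type*} [MeasurableSpace Ω]
    {μ : Measure Ω} [IsProbabilityMeasure μ] {G : J → Set Ω} (hG : ∀ j, MeasurableSet (G j))
    {M : ℕ} {δ : ℝ} (hδ : δ ≤ 1)
    (hstep : ∀ T : Finset J, ∀ i ∉ T, T.card < M →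
      δ * μ.real (⋂ j ∈ T, (G j)ᶜ) ≤ μ.real ((⋂ j ∈ T, (G j)ᶜ) ∩ G i))
    (T : Finset J) (hT : T.card ≤ M) : μ.real (⋂ j ∈ T, (G j)ᶜ) ≤ (1 - δ) ^ T.card := by
  classical
  induction T using Finset.induction_on with
  | empty => simp
  | insert i T hi ih =>
    rw [Finset.card_insert_of_notMem hi] at hT ⊢
    set B := ⋂ j ∈ T, (G j)ᶜ
    have hsplit : μ.real (B ∩ G i) + μ.real (B \ G i) = μ.real B :=
      measureReal_inter_add_sdiff (hG i)
    calc μ.real (⋂ j ∈ insert i T, (G j)ᶜ) = μ.real (B \ G i) := by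
          rw [Finset.set_biInter_insert, Set.inter_comm, Set.sdiff_eq]
      _ ≤ (1 - δ) * μ.real B := by linarith [hstep T i hi hT]
      _ ≤ (1 - δ) * (1 - δ) ^ T.card :=
          mul_le_mul_of_nonneg_left (ih (by lia)) (sub_nonneg.mpr hδ)
      _ = (1 - δ) ^ (T.card + 1) := (pow_succ' _ _).symm

theorem isMulRightInvariant_uniformOfFintype (G : Type*) [Group G] [Fintype G]
    [MeasurableSpace G] [DiscreteMeasurableSpace G] :
    (PMF.uniformOfFintype G).toMeasure.IsMulRightInvariant := by
  refine ⟨fun g => Measure.ext_of_singleton fun x => ?_⟩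
  rw [Measure.map_apply (measurable_mul_const g) (measurableSet_singleton x)]
  have hpre : (· * g) ⁻¹' {x} = {x * g⁻¹} := by ext; simp [eq_mul_inv_iff_mul_eq]
  simp only [hpre, PMF.toMeasure_apply_singleton _ _ (measurableSet_singleton _),
    PMF.uniformOfFintype_apply]

theorem pow_le_ncard_forall_apply_ne {ι α β : Type*} [Fintype ι] [Fintype α] {f : ι → α → β}
    (hf : ∀ l, Function.Injective (f l)) (b : β) :
    (Fintype.card α - 1) ^ Fintype.card ι ≤ {h : ι → α | ∀ l, f l (h l) ≠ b}.ncard := by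
  classical
  have hcard (l : ι) : Fintype.card α - 1 ≤ (Finset.univ.filter fun a => f l a ≠ b).card := by
    rw [← Finset.card_image_of_injective _ (hf l), ← Finset.filter_image (p := (· ≠ b)),
      Finset.filter_ne', ← Finset.card_univ, ← Finset.card_image_of_injective _ (hf l)]
    exact Finset.pred_card_le_card_erase
  calc (Fintype.card α - 1) ^ Fintype.card ι
      = ∏ _l : ι, (Fintype.card α - 1) := by simp
    _ ≤ ∏ l, (Finset.univ.filter fun a => f l a ≠ b).card :=
        Finset.prod_le_prod' fun l _ => hcard l
    _ = (Fintype.piFinset fun l => Finset.univ.filter fun a => f l a ≠ b).card :=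
        (Fintype.card_piFinset _).symm
    _ = {h : ι → α | ∀ l, f l (h l) ≠ b}.ncard := by
        rw [← Set.ncard_coe_finset]
        congr 1
        ext h
        simp

end Resampling

section Asymptotics

theorem exp_neg_div_mul_add_one_pow_le {x : ℝ} (hx : 0 < x) (n : ℕ) :
    Real.exp (-(n / x)) * (x + 1) ^ n ≤ x ^ n := by
  have hx1 : x + 1 ≤ Real.exp (1 / x) * x := by
    have := mul_le_mul_of_nonneg_right (Real.add_one_le_exp (1 / x)) hx.le
    rwa [add_mul, one_div_mul_cancel hx.ne', one_mul, add_comm] at this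
  calc Real.exp (-(n / x)) * (x + 1) ^ n
      ≤ Real.exp (-(n / x)) * (Real.exp (1 / x) * x) ^ n := by gcongr
    _ = Real.exp (-(n / x) + n * (1 / x)) * x ^ n := by
        rw [mul_pow, ← Real.exp_nat_mul, Real.exp_add, mul_assoc]
    _ = x ^ n := by rw [mul_one_div, neg_add_cancel, Real.exp_zero, one_mul]

theorem tendsto_mul_one_sub_pow {u δ : ℕ → ℝ} {p : ℕ} {γ : ℝ} (hγ : γ < 1)
    (hu : u =O[atTop] fun N => (N : ℝ) ^ p) (hδ : ∀ᶠ N : ℕ in atTop, (N : ℝ) ^ (-γ) ≤ δ N)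
    (hδ1 : ∀ N, δ N ≤ 1) :
    Tendsto (fun N => u N * (1 - δ N) ^ (N / 2)) atTop (𝓝 0) := by
  have hγ0 : 0 < 1 - γ := sub_pos.mpr hγ
  have hlim : Tendsto (fun N : ℕ => (N : ℝ) ^ p * Real.exp (-(1 / 3) * (N : ℝ) ^ (1 - γ)))
      atTop (𝓝 0) := by
    refine ((tendsto_rpow_mul_exp_neg_mul_atTop_nhds_zero (p / (1 - γ)) (1 / 3)
      (by norm_num)).comp ((tendsto_rpow_atTop hγ0).comp tendsto_natCast_atTop_atTop)).congr
      fun N => ?_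
    simp only [Function.comp_apply]
    rw [← Real.rpow_mul N.cast_nonneg, mul_div_cancel₀ _ hγ0.ne', Real.rpow_natCast]
  have hbound : (fun N => (1 - δ N) ^ (N / 2)) =O[atTop]
      fun N : ℕ => Real.exp (-(1 / 3) * (N : ℝ) ^ (1 - γ)) := by
    refine IsBigO.of_norm_eventuallyLE ?_
    filter_upwards [hδ, eventually_ge_atTop 2] with N hN hN2
    have hN0 : (0 : ℝ) < N := by exact_mod_cast (by lia : 0 < N)
    have hhalf : (N : ℝ) / 3 ≤ (N / 2 : ℕ) := by
      rw [div_le_iff₀ three_pos]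
      exact_mod_cast (by lia : N ≤ N / 2 * 3)
    rw [Real.norm_of_nonneg (pow_nonneg (sub_nonneg.mpr (hδ1 N)) _)]
    calc (1 - δ N) ^ (N / 2) ≤ Real.exp (-δ N) ^ (N / 2) :=
          pow_le_pow_left₀ (sub_nonneg.mpr (hδ1 N)) (Real.one_sub_le_exp_neg _) _
      _ = Real.exp (-((N / 2 : ℕ) * δ N)) := by rw [← Real.exp_nat_mul, mul_neg]
      _ ≤ Real.exp (-(N / 3 * (N : ℝ) ^ (-γ))) := by gcongr
      _ = Real.exp (-(1 / 3) * (N : ℝ) ^ (1 - γ)) := by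
          rw [sub_eq_add_neg, Real.rpow_add hN0, Real.rpow_one]
          ring_nf
  exact (hu.mul hbound).trans_tendsto hlim

theorem isLittleO_log_natCast : (fun N : ℕ => Real.log N) =o[atTop] fun N : ℕ => (N : ℝ) :=
  Real.isLittleO_log_id_atTop.comp_tendsto tendsto_natCast_atTop_atTop

theorem isLittleO_natCast_mul_log :
    (fun N : ℕ => (N : ℝ)) =o[atTop] fun N : ℕ => N * Real.log N := by
  have hlog : (fun _ : ℕ => (1 : ℝ)) =o[atTop] fun N : ℕ => Real.log N :=
    Real.isLittleO_const_log_atTop.comp_tendsto tendsto_natCast_atTop_atTop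
  simpa using (isBigO_refl (fun N : ℕ => (N : ℝ)) atTop).mul_isLittleO hlog

theorem eventually_rpow_neg_le_exp_neg {x : ℕ → ℝ} {c : ℝ}
    (hx : IsBigOWith c atTop x fun N => Real.log N) :
    ∀ᶠ N : ℕ in atTop, (N : ℝ) ^ (-c) ≤ Real.exp (-x N) := by
  filter_upwards [hx.bound, eventually_gt_atTop 0] with N hN hN0
  rw [Real.norm_of_nonneg (Real.log_natCast_nonneg N)] at hN
  rw [Real.rpow_def_of_pos (by exact_mod_cast hN0), Real.exp_le_exp]
  linarith [le_of_abs_le hN]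

end Asymptotics

variable {ι : Type*} {N K : ℕ}

section Weights

variable [Fintype ι]

theorem ae_sum_mul_ne (ν : ι → Measure ℝ) [∀ i, SigmaFinite (ν i)]
    [∀ i, NullSingletonClass (ν i)] {c : ι → ℝ} (hc : c ≠ 0) (t : ℝ) :
    ∀ᵐ w ∂Measure.pi ν, ∑ i, c i * w i ≠ t := by
  classical
  obtain ⟨i, hi⟩ := Function.ne_iff.mp hc
  set E : Set (ι → ℝ) := {w | ∑ j, c j * w j = t}
  have hmeas : MeasurableSet E := measurableSet_eq_fun (by fun_prop) measurable_const
  have hsection (w : ι → ℝ) : (Function.update w i ⁻¹' E).Subsingleton := by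
    intro x hx y hy
    have hxy : ∑ j, c j * Function.update w i x j = ∑ j, c j * Function.update w i y j :=
      hx.trans hy.symm
    simp only [← Finset.add_sum_erase _ _ (Finset.mem_univ i), Function.update_self] at hxy
    rw [Finset.sum_congr rfl fun j hj => by
      rw [Function.update_of_ne (Finset.ne_of_mem_erase hj),
        ← Function.update_of_ne (Finset.ne_of_mem_erase hj) y w]] at hxy
    exact mul_left_cancel₀ hi (add_right_cancel hxy)
  have hnull : ∫⁻ w, E.indicator 1 w ∂Measure.pi ν = ∫⁻ _, 0 ∂Measure.pi ν := by
    refine lintegral_eq_of_lmarginal_eq {i} (measurable_one.indicator hmeas) measurable_const ?_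
    ext w
    rw [lmarginal_singleton, lmarginal_singleton, lintegral_zero]
    exact (lintegral_indicator_one ((measurable_update w) hmeas)).trans
      ((hsection w).measure_zero _)
  rw [lintegral_indicator_one hmeas, lintegral_zero] at hnull
  simpa only [ae_iff, not_not] using hnull

theorem ae_linearIndependent_int (ν : ι → Measure ℝ) [∀ i, SigmaFinite (ν i)]
    [∀ i, NullSingletonClass (ν i)] :
    ∀ᵐ w ∂Measure.pi ν, LinearIndependent ℤ w := by
  have h (c : ι → ℤ) : ∀ᵐ w ∂Measure.pi ν, c ≠ 0 → ∑ i, (c i : ℝ) * w i ≠ 0 := by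
    by_cases hc : c = 0
    · simp [hc]
    · have hc' : (fun i => (c i : ℝ)) ≠ 0 := fun h => hc (funext fun i => by
        simpa using congrFun h i)
      exact (ae_sum_mul_ne ν hc' 0).mono fun _ hw _ => hw
  filter_upwards [ae_all_iff.mpr h] with w hw
  refine Fintype.linearIndependent_iff.mpr fun c hsum => ?_
  by_contra! hne
  exact hw c (Function.ne_iff.mpr hne) (by simpa only [zsmul_eq_mul] using hsum)

theorem sum_ne_zero_of_linearIndependent_int [Nonempty ι] {w : ι → ℝ}
    (hw : LinearIndependent ℤ w) : ∑ i, w i ≠ 0 := fun h =>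
  one_ne_zero <| Fintype.linearIndependent_iff.mp hw (fun _ => 1) (by simpa using h)
    (Classical.arbitrary ι)

theorem nullSingletonClass_cond {Ω : Type*} [MeasurableSpace Ω] (μ : Measure Ω)
    [NullSingletonClass μ] (s : Set Ω) : NullSingletonClass (cond μ s) :=
  ⟨fun x => cond_absolutelyContinuous (measure_singleton x)⟩

end Weights

section Generated

variable {s : Fin K → RankList N} {w : Fin K → ℝ}

theorem generated_apply_of_injective (hs : Function.Injective s) (k : Fin K) :
    generated s w (s k) = w k / ∑ j, w j := by
  simp [generated, hs.eq_iff]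

theorem mem_range_of_generated_ne_zero {τ : RankList N} (h : generated s w τ ≠ 0) :
    τ ∈ Set.range s := by
  obtain ⟨k, -, hk⟩ := Finset.exists_ne_zero_of_sum_ne_zero h
  exact ⟨k, by_contra fun hne => hk (if_neg hne)⟩

theorem generated_ne_zero_iff (hs : Function.Injective s) (hw : LinearIndependent ℤ w)
    {τ : RankList N} : generated s w τ ≠ 0 ↔ τ ∈ Set.range s := by
  refine ⟨mem_range_of_generated_ne_zero, ?_⟩
  rintro ⟨k, rfl⟩
  have : Nonempty (Fin K) := ⟨k⟩
  rw [generated_apply_of_injective hs]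
  exact div_ne_zero (hw.ne_zero k) (sum_ne_zero_of_linearIndependent_int hw)

theorem sparsity_generated (hs : Function.Injective s) (hw : LinearIndependent ℤ w) :
    sparsity (generated s w) = K := by
  simp only [sparsity, generated_ne_zero_iff hs hw, Set.ofPred_mem_eq]
  rw [← Set.image_univ, Set.ncard_image_of_injective _ hs, Set.ncard_univ, Nat.card_fin]

theorem sum_mul_generated (f : RankList N → ℝ) :
    ∑ τ, f τ * generated s w τ = (∑ k, f (s k) * w k) / ∑ j, w j := by
  simp only [generated, Finset.mul_sum]
  rw [Finset.sum_comm, Finset.sum_div]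
  exact Finset.sum_congr rfl fun k _ => by simp [mul_div_assoc]

theorem linearIndependenceCondition_generated (C : ℝ) (hw : LinearIndependent ℤ w) :
    LinearIndependenceCondition C (generated s w) := by
  rintro c - ⟨τ, hτ, hcτ⟩
  obtain ⟨k, rfl⟩ := mem_range_of_generated_ne_zero hτ
  have : Nonempty (Fin K) := ⟨k⟩
  rw [sum_mul_generated]
  refine div_ne_zero (fun h => hcτ ?_) (sum_ne_zero_of_linearIndependent_int hw)
  exact Fintype.linearIndependent_iff.mp hw (c ∘ s) (by simpa using h) k

end Generated

section Signatures

variable {X D : Type*} {A : Matrix D X ℝ}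

/-- The event that row `d` of `A` is a signature of the draw `s k`: it has the entry `1` at `s k`
and `0` at every other draw. -/
def signatureEvent (A : Matrix D X ℝ) (d : D) (k : ι) : Set (ι → X) :=
  {s | A d (s k) = 1 ∧ ∀ l, l ≠ k → A d (s l) = 0}

/-- The event that no row of `A` is a signature of the draw `s k`. -/
def noSignatureEvent (A : Matrix D X ℝ) (k : ι) : Set (ι → X) :=
  ⋂ d, (signatureEvent A d k)ᶜ

theorem mem_signatureEvent_iff {d : D} {P : X → Prop} [DecidablePred P]
    (hA : ∀ x, A d x = if P x then 1 else 0) {k : ι} {s : ι → X} :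
    s ∈ signatureEvent A d k ↔ ∀ l, P (s l) ↔ l = k := by
  simp only [signatureEvent, hA, Set.mem_ofPred_eq, ite_eq_left_iff, ite_eq_right_iff, zero_ne_one,
    one_ne_zero, imp_false, not_not]
  exact ⟨fun h l => ⟨fun hl => by_contra fun hne => h.2 l hne hl, fun hl => hl ▸ h.1⟩,
    fun h => ⟨(h k).mpr rfl, fun l hne hl => hne ((h l).mp hl)⟩⟩

theorem notMem_noSignatureEvent_iff {k : ι} {s : ι → X} :
    s ∉ noSignatureEvent A k ↔ ∃ d, s ∈ signatureEvent A d k := by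
  simp [noSignatureEvent]

theorem injective_of_forall_notMem_noSignatureEvent {s : ι → X}
    (hs : ∀ k, s ∉ noSignatureEvent A k) : Function.Injective s := by
  intro k l hkl
  obtain ⟨d, h1, h0⟩ := notMem_noSignatureEvent_iff.mp (hs k)
  by_contra hne
  exact one_ne_zero <| h1.symm.trans (hkl ▸ h0 l (Ne.symm hne))

theorem mem_goodEvent {A : Matrix D (RankList N) ℝ} {s : Fin K → RankList N} {w : Fin K → ℝ}
    (hs : ∀ k, s ∉ noSignatureEvent A k) (hw : LinearIndependent ℤ w) :
    (s, w) ∈ goodEvent K A := by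
  have hinj := injective_of_forall_notMem_noSignatureEvent hs
  refine ⟨sparsity_generated hinj hw, fun σ hσ => ?_,
    fun C _ => linearIndependenceCondition_generated C hw⟩
  obtain ⟨k, rfl⟩ := mem_range_of_generated_ne_zero hσ
  obtain ⟨d, h1, h0⟩ := notMem_noSignatureEvent_iff.mp (hs k)
  refine ⟨d, h1, fun τ hτ hne => ?_⟩
  obtain ⟨l, rfl⟩ := mem_range_of_generated_ne_zero hτ
  exact h0 l fun h => hne (by rw [h])

end Signatures

theorem measurableSet_rankLists [Finite ι] (S : Set (ι → RankList N)) : MeasurableSet S :=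
  S.toFinite.measurableSet

/-- The law of independent uniformly random rank lists, one for each index in `ι`. -/
noncomputable def rankListLaw (ι : Type*) [Fintype ι] (N : ℕ) : Measure (ι → RankList N) :=
  Measure.pi fun _ => (PMF.uniformOfFintype (RankList N)).toMeasure

/-- The generative model with an arbitrary law `ν` of the unnormalised weights: `drawLaw N K a b`
is the case in which `ν` is the uniform law on `[a, b]`. -/
noncomputable def modelLaw (N K : ℕ) (ν : Measure ℝ) :
    Measure ((Fin K → RankList N) × (Fin K → ℝ)) :=
  (rankListLaw (Fin K) N).prod (Measure.pi fun _ => ν)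

instance [Fintype ι] : IsProbabilityMeasure (rankListLaw ι N) := by
  unfold rankListLaw; infer_instance

instance [Fintype ι] : (rankListLaw ι N).IsMulRightInvariant :=
  have := isMulRightInvariant_uniformOfFintype (RankList N)
  Measure.pi.isMulRightInvariant _

instance (ν : Measure ℝ) [IsProbabilityMeasure ν] : IsProbabilityMeasure (modelLaw N K ν) := by
  unfold modelLaw; infer_instance

section Model

variable (ν : Measure ℝ) [IsProbabilityMeasure ν] [NullSingletonClass ν]

theorem one_sub_sum_le_modelLaw_goodEvent {D : Type*} (A : Matrix D (RankList N) ℝ) :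
    1 - ∑ k, rankListLaw (Fin K) N (noSignatureEvent A k) ≤ modelLaw N K ν (goodEvent K A) := by
  set W : Set (Fin K → ℝ) := {w | LinearIndependent ℤ w}
  set S : Set (Fin K → RankList N) := ⋃ k, noSignatureEvent A k
  have hW : Measure.pi (fun _ : Fin K => ν) W = 1 :=
    (measure_congr (eventuallyEq_univ.mpr (ae_linearIndependent_int _))).trans measure_univ
  calc 1 - ∑ k, rankListLaw (Fin K) N (noSignatureEvent A k)
      ≤ 1 - rankListLaw (Fin K) N S := tsub_le_tsub_left (measure_iUnion_fintype_le _ _) 1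
    _ = rankListLaw (Fin K) N Sᶜ := (prob_compl_eq_one_sub (measurableSet_rankLists S)).symm
    _ = modelLaw N K ν (Sᶜ ×ˢ W) := by rw [modelLaw, Measure.prod_prod, hW, mul_one]
    _ ≤ modelLaw N K ν (goodEvent K A) := measure_mono fun x hx =>
        mem_goodEvent (by simpa [S] using hx.1) hx.2

theorem tendsto_modelLaw_goodEvent {K : ℕ → ℕ} {D : ℕ → Type*}
    (A : ∀ N, Matrix (D N) (RankList N) ℝ) {ε : ℕ → ℝ}
    (hε : ∀ᶠ N in atTop, ∀ k,
      (rankListLaw (Fin (K N)) N).real (noSignatureEvent (A N) k) ≤ ε N)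
    (hlim : Tendsto (fun N => K N * ε N) atTop (𝓝 0)) :
    Tendsto (fun N => modelLaw N (K N) ν (goodEvent (K N) (A N))) atTop (𝓝 1) := by
  have hlow : Tendsto (fun N => 1 - ENNReal.ofReal (K N * ε N)) atTop (𝓝 1) := by
    simpa using ENNReal.Tendsto.sub (tendsto_const_nhds (x := (1 : ENNReal)))
      (ENNReal.tendsto_ofReal hlim) (Or.inl ENNReal.one_ne_top)
  refine tendsto_of_tendsto_of_tendsto_of_le_of_le' hlow tendsto_const_nhds ?_
    (Eventually.of_forall fun N => prob_le_one)
  filter_upwards [hε] with N hN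
  refine le_trans (tsub_le_tsub_left ?_ 1) (one_sub_sum_le_modelLaw_goodEvent ν (A N))
  calc ∑ k, rankListLaw (Fin (K N)) N (noSignatureEvent (A N) k)
      ≤ ∑ _k : Fin (K N), ENNReal.ofReal (ε N) := Finset.sum_le_sum fun k _ =>
        (ENNReal.le_ofReal_iff_toReal_le (measure_ne_top _ _)
          (measureReal_nonneg.trans (hN k))).mpr (hN k)
    _ = ENNReal.ofReal (K N * ε N) := by
      rw [ENNReal.ofReal_mul (by positivity)]
      simp

end Model

section Comparison

variable {J : Type*}

/-- The comparison of the two products in the `j`-th of a family of disjoint pairs. -/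
def comparisonRow (e : J × Bool ↪ Fin N) (j : J) : {p : Fin N × Fin N // p.1 ≠ p.2} :=
  ⟨(e (j, false), e (j, true)), by simp⟩

theorem mem_signatureEvent_comparisonRow {e : J × Bool ↪ Fin N} {j : J} {k : ι}
    {s : ι → RankList N} :
    s ∈ signatureEvent (comparisonMatrix N) (comparisonRow e j) k ↔
      ∀ l, s l (e (j, false)) < s l (e (j, true)) ↔ l = k :=
  mem_signatureEvent_iff
    (P := fun σ : RankList N => σ (e (j, false)) < σ (e (j, true))) fun _ => rfl

/-- The move that exchanges the products `p` and `q` in the rank lists selected by `h`. -/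
def swapWhere (p q : Fin N) (h : ι → Bool) : ι → RankList N :=
  fun l => if h l then Equiv.swap p q else 1

theorem exists_mul_swapWhere_mem_signatureEvent (e : J × Bool ↪ Fin N) (j : J) (k : ι)
    (s : ι → RankList N) :
    ∃ h, s * swapWhere (e (j, false)) (e (j, true)) h ∈
      signatureEvent (comparisonMatrix N) (comparisonRow e j) k := by
  classical
  refine ⟨fun l => !decide (s l (e (j, false)) < s l (e (j, true)) ↔ l = k),
    mem_signatureEvent_comparisonRow.mpr fun l => ?_⟩
  have hne : s l (e (j, false)) ≠ s l (e (j, true)) := by simp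
  by_cases h : s l (e (j, false)) < s l (e (j, true)) ↔ l = k
  · simp [swapWhere, h]
  · have hswap : s l (e (j, true)) < s l (e (j, false)) ↔ l = k := by
      rw [← not_le, hne.le_iff_lt]
      tauto
    simp [swapWhere, h, hswap]

theorem mul_swapWhere_mem_signatureEvent_iff {e : J × Bool ↪ Fin N} {i j : J} (hij : j ≠ i)
    {k : ι} {s : ι → RankList N} (h : ι → Bool) :
    s * swapWhere (e (i, false)) (e (i, true)) h ∈
        signatureEvent (comparisonMatrix N) (comparisonRow e j) k ↔
      s ∈ signatureEvent (comparisonMatrix N) (comparisonRow e j) k := by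
  have hfix (l : ι) (b : Bool) :
      (s * swapWhere (e (i, false)) (e (i, true)) h) l (e (j, b)) = s l (e (j, b)) := by
    by_cases hl : h l <;>
      simp [swapWhere, hl, Equiv.swap_apply_of_ne_of_ne, hij]
  simp only [mem_signatureEvent_comparisonRow, hfix]

variable [Fintype ι] (μ : Measure (ι → RankList N)) [IsProbabilityMeasure μ]
  [μ.IsMulRightInvariant]

theorem measureReal_noSignatureEvent_comparisonMatrix_le (k : ι) :
    μ.real (noSignatureEvent (comparisonMatrix N) k) ≤
      (1 - (2 ^ Fintype.card ι)⁻¹) ^ (N / 2) := by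
  classical
  obtain ⟨e⟩ : Nonempty (Fin (N / 2) × Bool ↪ Fin N) :=
    Function.Embedding.nonempty_of_card_le (by simpa using Nat.div_mul_le_self N 2)
  let G (j : Fin (N / 2)) : Set (ι → RankList N) :=
    signatureEvent (comparisonMatrix N) (comparisonRow e j) k
  have hstep (T : Finset (Fin (N / 2))) (i : Fin (N / 2)) (hi : i ∉ T) (_ : T.card < N / 2) :
      (2 ^ Fintype.card ι)⁻¹ * μ.real (⋂ j ∈ T, (G j)ᶜ) ≤ μ.real ((⋂ j ∈ T, (G j)ᶜ) ∩ G i) := by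
    rw [inv_mul_le_iff₀ (by positivity)]
    have := mul_measureReal_le_card_mul_measureReal_inter
      (fun h : ι → Bool => measurePreserving_mul_right μ
        (swapWhere (e (i, false)) (e (i, true)) h))
      (measurableSet_rankLists (⋂ j ∈ T, (G j)ᶜ)) (measurableSet_rankLists (G i))
      (fun h s hs => by
        simp only [Set.mem_iInter, Set.mem_compl_iff] at hs ⊢
        exact fun j hj => mt (mul_swapWhere_mem_signatureEvent_iff
          (ne_of_mem_of_not_mem hj hi) h).mp (hs j hj))
      (n := 1) (fun s _ => (Set.ncard_pos (Set.toFinite _)).mpr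
        (exists_mul_swapWhere_mem_signatureEvent e i k s))
    simpa using this
  calc μ.real (noSignatureEvent (comparisonMatrix N) k)
      ≤ μ.real (⋂ j ∈ Finset.univ, (G j)ᶜ) :=
        measureReal_mono (Set.subset_iInter₂ fun j _ => Set.iInter_subset _ (comparisonRow e j))
    _ ≤ (1 - (2 ^ Fintype.card ι)⁻¹) ^ (Finset.univ : Finset (Fin (N / 2))).card :=
        measureReal_biInter_compl_le_one_sub_pow (fun j => measurableSet_rankLists (G j))
          (inv_le_one_of_one_le₀ (one_le_pow₀ one_le_two)) hstep _ (by simp)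
    _ = (1 - (2 ^ Fintype.card ι)⁻¹) ^ (N / 2) := by simp

end Comparison

section Ranking

/-- The event that no other draw gives product `i` the rank it has in the draw `s k`. -/
def distinctRankEvent (k : ι) (i : Fin N) : Set (ι → RankList N) :=
  {s | ∀ l, l ≠ k → s l i ≠ s k i}

theorem noSignatureEvent_rankingMatrix_subset (k : ι) (i : Fin N) :
    noSignatureEvent (rankingMatrix N) k ⊆ (distinctRankEvent k i)ᶜ := by
  intro s hs hi
  refine notMem_noSignatureEvent_iff.mpr ⟨(s k i, i), ?_⟩ hs
  rw [mem_signatureEvent_iff (P := fun σ => σ i = s k i) fun _ => rfl]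
  exact fun l => ⟨fun hl => by_contra fun hne => hi l hne hl, fun hl => by rw [hl]⟩

open scoped Classical in
/-- The move that exchanges, in every draw `l` other than the draw `k`, the products `i` and
`h l`. -/
noncomputable def swapOthers (k : ι) (i : Fin N) (h : ι → Fin N) : ι → RankList N :=
  fun l => if l = k then 1 else Equiv.swap i (h l)

theorem mul_swapOthers_mem_distinctRankEvent_iff {k : ι} {i : Fin N} {h : ι → Fin N}
    {s : ι → RankList N} :
    s * swapOthers k i h ∈ distinctRankEvent k i ↔ ∀ l, l ≠ k → s l (h l) ≠ s k i := by
  refine forall₂_congr fun l hl => ?_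
  simp [swapOthers, hl]

theorem mul_swapOthers_mem_distinctRankEvent_iff_of_ne {k : ι} {i j : Fin N} {h : ι → Fin N}
    (hi : j ≠ i) (hh : ∀ l, j ≠ h l) {s : ι → RankList N} :
    s * swapOthers k i h ∈ distinctRankEvent k j ↔ s ∈ distinctRankEvent k j := by
  have hfix (l : ι) : (s * swapOthers k i h) l j = s l j := by
    by_cases hl : l = k <;> simp [swapOthers, hl, Equiv.swap_apply_of_ne_of_ne hi (hh l)]
  simp only [distinctRankEvent, Set.mem_ofPred_eq, hfix]

variable [Fintype ι] (μ : Measure (ι → RankList N)) [IsProbabilityMeasure μ]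
  [μ.IsMulRightInvariant]

theorem pow_mul_measureReal_biInter_compl_le (k : ι) {T : Finset (Fin N)} {i : Fin N}
    (hi : i ∉ T) :
    ((N - T.card - 1 : ℕ) : ℝ) ^ Fintype.card ι *
        μ.real (⋂ j ∈ T, (distinctRankEvent k j)ᶜ) ≤
      ((N - T.card : ℕ) : ℝ) ^ Fintype.card ι *
        μ.real ((⋂ j ∈ T, (distinctRankEvent k j)ᶜ) ∩ distinctRankEvent k i) := by
  classical
  have hcard : Fintype.card {j // j ∉ T} = N - T.card := by simp
  have := mul_measureReal_le_card_mul_measureReal_inter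
    (fun h : ι → {j // j ∉ T} => measurePreserving_mul_right μ (swapOthers k i fun l => (h l).1))
    (measurableSet_rankLists (⋂ j ∈ T, (distinctRankEvent k j)ᶜ))
    (measurableSet_rankLists (distinctRankEvent k i))
    (fun h s hs => by
      simp only [Set.mem_iInter, Set.mem_compl_iff] at hs ⊢
      exact fun j hj => mt (mul_swapOthers_mem_distinctRankEvent_iff_of_ne
        (ne_of_mem_of_not_mem hj hi) fun l => ne_of_mem_of_not_mem hj (h l).2).mp (hs j hj))
    (n := (N - T.card - 1) ^ Fintype.card ι) (fun s _ => by
      rw [← hcard]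
      refine (pow_le_ncard_forall_apply_ne (f := fun l (j : {j // j ∉ T}) => s l j)
        (fun l => (s l).injective.comp Subtype.val_injective) (s k i)).trans
        (Set.ncard_le_ncard (fun h hh => ?_) (Set.toFinite _))
      exact mul_swapOthers_mem_distinctRankEvent_iff.mpr fun l _ => hh l)
  rw [Fintype.card_fun, hcard] at this
  exact_mod_cast this

theorem exp_mul_measureReal_biInter_compl_le (k : ι) {T : Finset (Fin N)} {i : Fin N}
    (hi : i ∉ T) (hT : T.card < N / 2) :
    Real.exp (-(2 * Fintype.card ι / N)) * μ.real (⋂ j ∈ T, (distinctRankEvent k j)ᶜ) ≤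
      μ.real ((⋂ j ∈ T, (distinctRankEvent k j)ᶜ) ∩ distinctRankEvent k i) := by
  have hresample := pow_mul_measureReal_biInter_compl_le μ k hi
  obtain ⟨m, hm⟩ : ∃ m, N - T.card = m + 1 := ⟨N - T.card - 1, by lia⟩
  rw [hm, Nat.add_sub_cancel, Nat.cast_add_one] at hresample
  have hm0 : (0 : ℝ) < m := by exact_mod_cast (by lia : 0 < m)
  have hN0 : (0 : ℝ) < N := by exact_mod_cast (by lia : 0 < N)
  have hNm : (N : ℝ) ≤ 2 * m := by exact_mod_cast (by lia : N ≤ 2 * m)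
  have hexp : Real.exp (-(2 * Fintype.card ι / N)) ≤ Real.exp (-(Fintype.card ι / m)) := by
    rw [Real.exp_le_exp, neg_le_neg_iff, div_le_div_iff₀ hm0 hN0]
    nlinarith [(Nat.cast_nonneg (Fintype.card ι) : (0 : ℝ) ≤ Fintype.card ι)]
  set B := ⋂ j ∈ T, (distinctRankEvent k j)ᶜ
  refine le_of_mul_le_mul_left ?_ (by positivity : 0 < ((m : ℝ) + 1) ^ Fintype.card ι)
  calc ((m : ℝ) + 1) ^ Fintype.card ι * (Real.exp (-(2 * Fintype.card ι / N)) * μ.real B)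
      ≤ ((m : ℝ) + 1) ^ Fintype.card ι * (Real.exp (-(Fintype.card ι / m)) * μ.real B) := by
        gcongr
    _ = Real.exp (-(Fintype.card ι / m)) * ((m : ℝ) + 1) ^ Fintype.card ι * μ.real B := by ring
    _ ≤ (m : ℝ) ^ Fintype.card ι * μ.real B := by
        gcongr
        exact exp_neg_div_mul_add_one_pow_le hm0 _
    _ ≤ _ := hresample

theorem measureReal_noSignatureEvent_rankingMatrix_le (k : ι) :
    μ.real (noSignatureEvent (rankingMatrix N) k) ≤
      (1 - Real.exp (-(2 * Fintype.card ι / N))) ^ (N / 2) := by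
  obtain ⟨T, -, hT⟩ := Finset.exists_subset_card_eq (s := (Finset.univ : Finset (Fin N)))
    (n := N / 2) (by simpa using Nat.div_le_self N 2)
  calc μ.real (noSignatureEvent (rankingMatrix N) k)
      ≤ μ.real (⋂ j ∈ T, (distinctRankEvent k j)ᶜ) :=
        measureReal_mono (Set.subset_iInter₂ fun j _ => noSignatureEvent_rankingMatrix_subset k j)
    _ ≤ (1 - Real.exp (-(2 * Fintype.card ι / N))) ^ T.card :=
        measureReal_biInter_compl_le_one_sub_pow (fun j => measurableSet_rankLists _)
          (Real.exp_le_one_iff.mpr (neg_nonpos.mpr (by positivity)))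
          (fun _ _ hi => exp_mul_measureReal_biInter_compl_le μ k hi) T hT.le
    _ = (1 - Real.exp (-(2 * Fintype.card ι / N))) ^ (N / 2) := by rw [hT]

end Ranking

section TopSet

theorem exists_symm_eq_of_mem_noSignatureEvent_topSetMatrix [NeZero N] {k : ι}
    {s : ι → RankList N} (hs : s ∈ noSignatureEvent (topSetMatrix N) k) :
    ∃ l ≠ k, (s l).symm 0 = (s k).symm 0 := by
  by_contra! hne
  refine notMem_noSignatureEvent_iff.mpr ⟨Sum.inr ((s k).symm 0), ?_⟩ hs
  rw [mem_signatureEvent_iff (P := fun σ => (σ ((s k).symm 0) : ℕ) = 0) fun _ => rfl]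
  refine fun l => ⟨fun hl => by_contra fun hlk => hne l hlk ?_, fun hl => by simp [hl]⟩
  exact (Equiv.symm_apply_eq _).mpr (Fin.ext (by simpa using hl.symm))

variable (μ : Measure (ι → RankList N)) [IsProbabilityMeasure μ] [μ.IsMulRightInvariant]

theorem measureReal_symm_eq_symm_le [Finite ι] [NeZero N] {k l : ι} (hlk : l ≠ k) (r : Fin N) :
    μ.real {s | (s l).symm r = (s k).symm r} ≤ 1 / N := by
  classical
  set E : Set (ι → RankList N) := {s | (s l).symm r = (s k).symm r}
  let shift (c : Fin N) : ι → RankList N := Pi.mulSingle l (Equiv.addRight c)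
  have hmem (c : Fin N) (s : ι → RankList N) :
      s * shift c ∈ E ↔ (s l).symm r - (s k).symm r = c := by
    simp only [E, shift, Set.mem_ofPred_eq, Pi.mul_apply, Pi.mulSingle_eq_same,
      Pi.mulSingle_eq_of_ne hlk.symm, mul_one, Equiv.Perm.mul_def, Equiv.symm_trans_apply,
      Equiv.addRight_symm, Equiv.coe_addRight, ← sub_eq_add_neg]
    rw [sub_eq_iff_eq_add, sub_eq_iff_eq_add']
  have hdisj : Pairwise (Function.onFun Disjoint fun c => (· * shift c) ⁻¹' E) :=
    fun c d hcd => Set.disjoint_left.mpr fun s hc hd =>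
      hcd (((hmem c s).mp hc).symm.trans ((hmem d s).mp hd))
  rw [le_div_iff₀ (by exact_mod_cast NeZero.pos N), mul_comm]
  calc N * μ.real E = ∑ c, μ.real ((· * shift c) ⁻¹' E) := by
        simp [measureReal_def, (measurePreserving_mul_right μ _).measure_preimage
          (measurableSet_rankLists E).nullMeasurableSet]
    _ = μ.real (⋃ c, (· * shift c) ⁻¹' E) :=
        (measureReal_iUnion_fintype hdisj fun c => measurableSet_rankLists _).symm
    _ ≤ 1 := measureReal_le_one

theorem measureReal_noSignatureEvent_topSetMatrix_le [Fintype ι] [NeZero N] (k : ι) :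
    μ.real (noSignatureEvent (topSetMatrix N) k) ≤ Fintype.card ι / N := by
  classical
  calc μ.real (noSignatureEvent (topSetMatrix N) k)
      ≤ μ.real (⋃ l ∈ Finset.univ.erase k, {s | (s l).symm 0 = (s k).symm 0}) :=
        measureReal_mono (fun s hs => by
          simpa using exists_symm_eq_of_mem_noSignatureEvent_topSetMatrix hs) (measure_ne_top _ _)
    _ ≤ ∑ l ∈ Finset.univ.erase k, μ.real {s | (s l).symm 0 = (s k).symm 0} :=
        measureReal_biUnion_finset_le _ _
    _ ≤ ∑ l ∈ Finset.univ.erase k, 1 / (N : ℝ) := Finset.sum_le_sum fun l hl =>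
        measureReal_symm_eq_symm_le μ (Finset.ne_of_mem_erase hl) 0
    _ ≤ ∑ _l : ι, 1 / (N : ℝ) :=
        Finset.sum_le_sum_of_subset_of_nonneg (Finset.erase_subset _ _) fun _ _ _ => by positivity
    _ = Fintype.card ι / N := by simp [div_eq_mul_inv]

end TopSet

section DataTypes

variable (ν : Measure ℝ) [IsProbabilityMeasure ν] [NullSingletonClass ν] {K : ℕ → ℕ}

theorem tendsto_modelLaw_goodEvent_comparisonMatrix {c : ℝ} (hc : c * Real.log 2 < 1)
    (hK : IsBigOWith c atTop (fun N => (K N : ℝ)) fun N => Real.log N) :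
    Tendsto (fun N => modelLaw N (K N) ν (goodEvent (K N) (comparisonMatrix N))) atTop (𝓝 1) := by
  have hexp (N : ℕ) : Real.exp (-(Real.log 2 * K N)) = (2 ^ K N)⁻¹ := by
    rw [Real.exp_neg, Real.exp_mul, Real.exp_log two_pos, Real.rpow_natCast]
  have hδ := eventually_rpow_neg_le_exp_neg (hK.const_mul_left (Real.log 2))
  simp only [hexp, Real.norm_of_nonneg (Real.log_nonneg one_le_two), mul_comm _ c] at hδ
  refine tendsto_modelLaw_goodEvent ν comparisonMatrix
    (.of_forall fun N k => measureReal_noSignatureEvent_comparisonMatrix_le _ k) ?_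
  simp only [Fintype.card_fin]
  refine tendsto_mul_one_sub_pow (p := 1) hc ?_ hδ fun N =>
    inv_le_one_of_one_le₀ (one_le_pow₀ one_le_two)
  simpa only [pow_one] using hK.isBigO.trans isLittleO_log_natCast.isBigO

theorem tendsto_modelLaw_goodEvent_rankingMatrix {c : ℝ} (hc : c < 1 / 2)
    (hK : IsBigOWith c atTop (fun N => (K N : ℝ)) fun N => N * Real.log N) :
    Tendsto (fun N => modelLaw N (K N) ν (goodEvent (K N) (rankingMatrix N))) atTop (𝓝 1) := by
  have hload : IsBigOWith (2 * c) atTop (fun N => 2 * (K N : ℝ) / N) fun N => Real.log N := by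
    refine .of_bound ?_
    filter_upwards [hK.bound, eventually_gt_atTop 0] with N hN hN0
    have hN0' : (0 : ℝ) < N := by exact_mod_cast hN0
    rw [norm_mul, Real.norm_of_nonneg N.cast_nonneg, Real.norm_of_nonneg (K N).cast_nonneg] at hN
    rw [Real.norm_of_nonneg (by positivity), div_le_iff₀ hN0']
    linarith
  refine tendsto_modelLaw_goodEvent ν rankingMatrix
    (.of_forall fun N k => measureReal_noSignatureEvent_rankingMatrix_le _ k) ?_
  simp only [Fintype.card_fin]
  refine tendsto_mul_one_sub_pow (p := 2) (by linarith) ?_ (eventually_rpow_neg_le_exp_neg hload)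
    fun N => Real.exp_le_one_iff.mpr (neg_nonpos.mpr (by positivity))
  simpa only [sq] using hK.isBigO.trans
    ((isBigO_refl (fun N : ℕ => (N : ℝ)) atTop).mul isLittleO_log_natCast.isBigO)

theorem tendsto_modelLaw_goodEvent_topSetMatrix
    (hK : (fun N => (K N : ℝ)) =o[atTop] fun N : ℕ => Real.sqrt N) :
    Tendsto (fun N => modelLaw N (K N) ν (goodEvent (K N) (topSetMatrix N))) atTop (𝓝 1) := by
  refine tendsto_modelLaw_goodEvent ν topSetMatrix (ε := fun N => K N / N) ?_ ?_
  · filter_upwards [eventually_gt_atTop 0] with N hN k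
    have : NeZero N := .of_pos hN
    simpa using measureReal_noSignatureEvent_topSetMatrix_le (rankListLaw (Fin (K N)) N) k
  · have hsq := hK.tendsto_div_nhds_zero.pow 2
    simpa only [div_pow, Real.sq_sqrt (Nat.cast_nonneg _), sq (K _ : ℝ), mul_div_assoc, ne_eq,
      OfNat.ofNat_ne_zero, not_false_eq_true, zero_pow] using hsq

end DataTypes

end ChoiceModel

theorem theorem3_general (ν : Measure ℝ) [IsProbabilityMeasure ν] [NullSingletonClass ν]
    (K : ℕ → ℕ) :
    ((∃ c, c * Real.log 2 < 1 ∧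
        IsBigOWith c atTop (fun N => (K N : ℝ)) fun N => Real.log N) →
      Tendsto (fun N => ChoiceModel.modelLaw N (K N) ν
        (ChoiceModel.goodEvent (K N) (ChoiceModel.comparisonMatrix N))) atTop (𝓝 1)) ∧
    ((fun N => (K N : ℝ)) =o[atTop] (fun N : ℕ => Real.sqrt N) →
      Tendsto (fun N => ChoiceModel.modelLaw N (K N) ν
        (ChoiceModel.goodEvent (K N) (ChoiceModel.topSetMatrix N))) atTop (𝓝 1)) ∧
    ((∃ c < 1 / 2, IsBigOWith c atTop (fun N => (K N : ℝ)) fun N => N * Real.log N) →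
      Tendsto (fun N => ChoiceModel.modelLaw N (K N) ν
        (ChoiceModel.goodEvent (K N) (ChoiceModel.rankingMatrix N))) atTop (𝓝 1)) :=
  ⟨fun ⟨_, hc, hK⟩ => ChoiceModel.tendsto_modelLaw_goodEvent_comparisonMatrix ν hc hK,
    ChoiceModel.tendsto_modelLaw_goodEvent_topSetMatrix ν,
    fun ⟨_, hc, hK⟩ => ChoiceModel.tendsto_modelLaw_goodEvent_rankingMatrix ν hc hK⟩

theorem theorem3 (a b : ℝ) (ha : 0 ≤ a) (hab : a < b) (K : ℕ → ℕ) (hK : ∀ N, 1 ≤ K N) :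
    ((fun N : ℕ => (K N : ℝ)) =o[atTop] (fun N : ℕ => Real.log (N : ℝ)) →
      Tendsto (fun N : ℕ => ChoiceModel.drawLaw N (K N) a b
        (ChoiceModel.goodEvent (K N) (ChoiceModel.comparisonMatrix N))) atTop (𝓝 1)) ∧
    ((fun N : ℕ => (K N : ℝ)) =o[atTop] (fun N : ℕ => Real.sqrt (N : ℝ)) →
      Tendsto (fun N : ℕ => ChoiceModel.drawLaw N (K N) a b
        (ChoiceModel.goodEvent (K N) (ChoiceModel.topSetMatrix N))) atTop (𝓝 1)) ∧
    ((fun N : ℕ => (K N : ℝ)) =O[atTop] (fun N : ℕ => (N : ℝ)) →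
      Tendsto (fun N : ℕ => ChoiceModel.drawLaw N (K N) a b
        (ChoiceModel.goodEvent (K N) (ChoiceModel.rankingMatrix N))) atTop (𝓝 1)) := by
  have : IsProbabilityMeasure (cond volume (Set.Icc a b)) :=
    cond_isProbabilityMeasure_of_finite (by simpa using hab) (by simp)
  have := ChoiceModel.nullSingletonClass_cond volume (Set.Icc a b)
  obtain ⟨hcomparison, htopSet, hranking⟩ := theorem3_general (cond volume (Set.Icc a b)) K
  exact ⟨fun h => hcomparison ⟨1, by linarith [Real.log_two_lt_d9], h.forall_isBigOWith one_pos⟩,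
    htopSet, fun h => hranking ⟨1 / 4, by norm_num,
      (h.trans_isLittleO ChoiceModel.isLittleO_natCast_mul_log).forall_isBigOWith (by norm_num)⟩⟩
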